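/- Let $a,b,c,d\ge 0$ satisfy $a+c=b+d>0$, and put $p=\frac{a}{a+c}$, $r=\frac{b}{b+d}$ and $\lambda=\max(|1-2p|,|1-2r|)$. For a probability measure $\mu$ on $\{0,1\}^{\mathbb Z}$ let $\mathcal L(\mu;p,r)$ be the law of the random field $(e(i,t))_{i\in\mathbb Z,\,t\in\mathbb N}$, with values in $\{0,1\}$, defined as follows. The line $(e(i,0))_{i\in\mathbb Z}$ has law $\mu$, and the lines $(e(i,t))_{i\in\mathbb Z}$, $t=0,1,2,\dots$, form a Markov chain. To pass from time $t$ to time $t+1$, group the sites into the pairs $(2n,2n+1)$, $n\in\mathbb Z$, if $t$ is even, and into the pairs $(2n-1,2n)$, $n\in\mathbb Z$, if $t$ is odd. Given line $t$, the pairs of line $t+1$ are independent; each depends only on the same pair on line $t$, and for $k\in\{0,1\}$ a pair $(k,k)$ stays $(k,k)$ with probability $r$ and becomes $(1-k,1-k)$ with probability $1-r$, while a pair $(k,1-k)$ becomes $(1-k,k)$ with probability $p$ and stays $(k,1-k)$ with probability $1-p$. The edge correlation function is $$C((i,t);(i',t'))=\frac{\operatorname{Cov}(e(i,t),e(i',t'))}{\sqrt{\operatorname{Var}e(i,t)}\,\sqrt{\operatorname{Var}e(i',t')}},$$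 and $C_8(i,t)$ denotes $C((0,0);(i,t))$ in the case where $\mu$ is the product of Bernoulli$(1/2)$ laws (the infinite-volume 8-vertex model with free boundary conditions). Let $\mu$ be any probability measure on $\{0,1\}^{\mathbb Z}$ such that $\operatorname{Var}e(0,0)\neq 0$ under $\mathcal L(\mu;p,r)$. Then, under $\mathcal L(\mu;p,r)$, for every $i\in\mathbb Z$ and every $t\in\mathbb N$ (including $t=0$), $$\left|\sqrt{\frac{\operatorname{Var}e(i,t)}{\operatorname{Var}e(0,0)}}\;C((0,0);(i,t))-C_8(i,t)\right|\le 2\left(\lambda^{\,t-1-\lfloor t/2\rfloor}+\lambda^{\lfloor t/2\rfloor}-\lambda^{\,t-1}\right),$$ where the product $\sqrt{\operatorname{Var}e(i,t)/\operatorname{Var}e(0,0)}\;C((0,0);(i,t))$ is read as $0$ if $\operatorname{Var}e(i,t)=0$, $0^0=1$, and at $t=0$ the right-hand side is $2$ (the two terms $\lambda^{-1}$ cancel). -/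

import Mathlib

open MeasureTheory ProbabilityTheory
open scoped NNReal ENNReal

noncomputable section

namespace EightVertex

/-- A line of edge orientations, indexed by the abscissa; `true` stands for the state `1`
(up-oriented edge) and `false` for the state `0` (down-oriented edge). -/
abbrev Line : Type := ℤ → Bool

/-- A configuration: `O t i` is the state of the edge numbered `(i, t)`. -/
abbrev Config : Type := ℕ → Line

/-- The product measure of parameter `q` on `{0,1}^ℤ`: i.i.d. Bernoulli variables of parameter
`q`. -/
def productMeasure (q : unitInterval) : Measure Line :=
  Measure.infinitePi fun _ : ℤ =>
    ENNReal.ofReal (q : ℝ) • Measure.dirac true + ENNReal.ofReal (1 - (q : ℝ)) • Measure.dirac false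

/-- The local transition law from the states `x` of a pair of neighbouring edges:
`(k, k)` stays `(k, k)` with probability `r` and becomes `(1-k, 1-k)` with probability `1-r`;
`(k, 1-k)` becomes `(1-k, k)` with probability `p` and stays `(k, 1-k)` with probability `1-p`. -/
def pairLaw (p r : unitInterval) (x : Bool × Bool) : Measure (Bool × Bool) :=
  if x.1 = x.2 then
    ENNReal.ofReal (r : ℝ) • Measure.dirac x
      + ENNReal.ofReal (1 - (r : ℝ)) • Measure.dirac (!x.1, !x.2)
  else
    ENNReal.ofReal (p : ℝ) • Measure.dirac (!x.1, !x.2)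
      + ENNReal.ofReal (1 - (p : ℝ)) • Measure.dirac x

/-- The line cut into pairs: for `u = 0` the pair number `n` has abscissas `(2n, 2n+1)`, for
`u = 1` it has abscissas `(2n-1, 2n)`. -/
def toPairs (u : ℕ) (η : Line) (n : ℤ) : Bool × Bool :=
  (η (2 * n - u), η (2 * n + 1 - u))

/-- The line with given pairs (the inverse of `toPairs u`). -/
def ofPairs (u : ℕ) (w : ℤ → Bool × Bool) (j : ℤ) : Bool :=
  if (j + u) % 2 = 0 then (w ((j + u) / 2)).1 else (w ((j + u) / 2)).2

theorem ofPairs_toPairs (u : ℕ) (η : Line) : ofPairs u (toPairs u η) = η := by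
  funext j
  unfold ofPairs toPairs
  split_ifs with h
  · exact congrArg η (by omega)
  · exact congrArg η (by omega)

theorem toPairs_ofPairs (u : ℕ) (w : ℤ → Bool × Bool) : toPairs u (ofPairs u w) = w := by
  funext n
  have h1 : (2 * n - (u : ℤ) + u) % 2 = 0 := by omega
  have h2 : (2 * n - (u : ℤ) + u) / 2 = n := by omega
  have h3 : ¬ (2 * n + 1 - (u : ℤ) + u) % 2 = 0 := by omega
  have h4 : (2 * n + 1 - (u : ℤ) + u) / 2 = n := by omega
  unfold toPairs ofPairs
  rw [if_pos h1, if_neg h3, h2, h4]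

theorem measurable_toPairs (u : ℕ) : Measurable (toPairs u) :=
  measurable_pi_lambda _ fun _ => (measurable_pi_apply _).prodMk (measurable_pi_apply _)

theorem measurable_ofPairs (u : ℕ) : Measurable (ofPairs u) := by
  refine measurable_pi_lambda _ fun j => ?_
  unfold ofPairs
  split_ifs
  · exact measurable_fst.comp (measurable_pi_apply _)
  · exact measurable_snd.comp (measurable_pi_apply _)

instance (p r : unitInterval) (x : Bool × Bool) : IsProbabilityMeasure (pairLaw p r x) := by
  constructor
  have h : ∀ s : unitInterval, ENNReal.ofReal (s : ℝ) + ENNReal.ofReal (1 - (s : ℝ)) = 1 := by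
    intro s
    rw [← ENNReal.ofReal_add s.2.1 (sub_nonneg.2 s.2.2)]
    simp
  unfold pairLaw
  split_ifs <;> simp [h]

instance (q : unitInterval) : IsProbabilityMeasure (productMeasure q) := by
  have : IsProbabilityMeasure (ENNReal.ofReal (q : ℝ) • Measure.dirac true
      + ENNReal.ofReal (1 - (q : ℝ)) • Measure.dirac false) := by
    constructor
    have h : ENNReal.ofReal (q : ℝ) + ENNReal.ofReal (1 - (q : ℝ)) = 1 := by
      rw [← ENNReal.ofReal_add q.2.1 (sub_nonneg.2 q.2.2)]
      simp
    simp [h]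
  unfold productMeasure
  infer_instance

theorem measurable_infinitePi_pairLaw (p r : unitInterval) :
    Measurable fun w : ℤ → Bool × Bool => Measure.infinitePi fun n => pairLaw p r (w n) := by
  refine Measurable.measure_of_isPiSystem_of_isProbabilityMeasure
    (generateFrom_squareCylinders (α := fun _ : ℤ => Bool × Bool)).symm
    (isPiSystem_squareCylinders (fun _ => MeasurableSpace.isPiSystem_measurableSet) (by simp)) ?_
  rintro s ⟨I, t, ht, rfl⟩
  have ht' : ∀ i ∈ I, MeasurableSet (t i) := fun i _ => ht i (Set.mem_univ i)
  simp_rw [Measure.infinitePi_pi _ ht']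
  refine Finset.measurable_fun_prod _ fun i _ => ?_
  exact (measurable_of_countable fun x => pairLaw p r x (t i)).comp (measurable_pi_apply i)

/-- The one-step transition kernel `T_u` (`u = 0` at even times, `u = 1` at odd times): given the
current line, the pairs of the next line are independent, and each of them has the local
transition law from the current states of the same pair. -/
def step (p r : unitInterval) (u : ℕ) : Kernel Line Line where
  toFun η := (Measure.infinitePi fun n : ℤ => pairLaw p r (toPairs u η n)).map (ofPairs u)
  measurable' := (Measure.measurable_map _ (measurable_ofPairs u)).comp
    ((measurable_infinitePi_pairLaw p r).comp (measurable_toPairs u))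

instance (p r : unitInterval) (u : ℕ) : IsMarkovKernel (step p r u) :=
  ⟨fun _ => Measure.isProbabilityMeasure_map (measurable_ofPairs u).aemeasurable⟩

/-- The law `L(μ; p, r)` of `(e(i,t) : i ∈ ℤ, t ∈ ℕ)`: the trajectory law of the Markov chain with
initial law `μ` on the line `t = 0` whose transition from line `t` to line `t + 1` is `T_0` for
even `t` and `T_1` for odd `t`. -/
def law (μ : Measure Line) (p r : unitInterval) : Measure Config :=
  Kernel.trajMeasure (X := fun _ => Line) μ fun t =>
    (step p r (t % 2)).comap (fun h => h ⟨t, Finset.mem_Iic.2 le_rfl⟩) (measurable_pi_apply _)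

/-- The random variable `e(i,t)`, with values `0` and `1`, for the edge `x = (i, t)`. -/
def e (x : ℤ × ℕ) (O : Config) : ℝ := if O x.2 x.1 then 1 else 0

/-- The edge correlation function `C(x; y)` of a random configuration with law `P`. -/
def edgeCorr (P : Measure Config) (x y : ℤ × ℕ) : ℝ :=
  cov[e x, e y; P] / (√Var[e x; P] * √Var[e y; P])

/-- The parameter `x / (x + y)` of a pair of weights. -/
def ratio (x y : ℝ≥0) : unitInterval :=
  ⟨(x : ℝ) / (x + y), by positivity,
    div_le_one_of_le₀ (le_add_of_nonneg_right y.2) (by positivity)⟩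

/-- The infinite-volume 8-vertex law with free boundary condition and weights `a, b, c, d`,
`a + c = b + d`: the law `L(PM(1/2); a/(a+c), b/(b+d))`. -/
def freeLaw (a b c d : ℝ≥0) : Measure Config :=
  law (productMeasure ⟨1 / 2, by norm_num, by norm_num⟩) (ratio a c) (ratio b d)

/-- `C_8(i,t) = C_8((0,0);(i,t))`, the stationary edge correlation function. -/
def C8 (a b c d : ℝ≥0) (i : ℤ) (t : ℕ) : ℝ := edgeCorr (freeLaw a b c d) (0, 0) (i, t)

/-- `λ(p, r) = max(|1 - 2p|, |1 - 2r|)`. -/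
def lam (p r : unitInterval) : ℝ := max |1 - 2 * (p : ℝ)| |1 - 2 * (r : ℝ)|

end EightVertex

end

open EightVertex

noncomputable section

namespace EightVertex

/-! Passing to spins `2 e - 1` makes the dynamics linear in the mean: given line `t`, the expected
spin at a site of line `t + 1` is `r - p` times the old spin there plus `r + p - 1` times the old
spin of its partner. Since `|r - p| + |r + p - 1| ≤ λ`, iteration writes the mean spin of `(i, t)`
given line `0` as `∑ w j * spin (η j)` with `∑ |w j| ≤ λ ^ t` (`exists_spin_weights`). The weights
do not depend on `μ`.

Hence the normalised correlation is `∑ w j * cov(η 0, η j) / Var(η 0)` under `μ`, while for fair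
independent bits only `j = 0` survives (`C8_eq`). The `j = 0` terms cancel in the difference. Every
other ratio is at most `1` in absolute value, because the covariance of two indicators is bounded by
the variance of either (`abs_covariance_bit_le`). The difference is thus at most `λ ^ t`, which is
below the stated bound. -/

/-- The spin `2 e - 1 ∈ {-1, 1}` of a state. -/
def spin (x : Bool) : ℝ := if x then 1 else -1

theorem abs_spin (x : Bool) : |spin x| = 1 := by cases x <;> simp [spin]

/-! ### One step: linearity of the mean spin -/

theorem integral_pairLaw (p r : unitInterval) (x : Bool × Bool) (f : Bool × Bool → ℝ) :
    ∫ y, f y ∂pairLaw p r x = if x.1 = x.2 then r * f x + (1 - r) * f (!x.1, !x.2)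
      else p * f (!x.1, !x.2) + (1 - p) * f x := by
  have hp := p.2.1
  have hr := r.2.1
  have hp' := sub_nonneg.2 p.2.2
  have hr' := sub_nonneg.2 r.2.2
  unfold pairLaw
  split_ifs with h
  all_goals
    rw [integral_add_measure, integral_smul_measure, integral_smul_measure]
    · simp [*]
    all_goals exact (integrable_dirac (by simp)).smul_measure (by simp)

/-- The mean factor on the spin is `2r - 1` for equal states and `1 - 2p` for opposite ones; the two
coefficients are chosen to have these values as sum and difference. -/
theorem integral_spin_fst_pairLaw (p r : unitInterval) (x : Bool × Bool) :
    ∫ y, spin y.1 ∂pairLaw p r x = (r - p) * spin x.1 + (r + p - 1) * spin x.2 := by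
  rw [integral_pairLaw p r x fun y => spin y.1]
  rcases x with ⟨x, y⟩
  cases x <;> cases y <;> simp [spin] <;> ring

theorem integral_spin_snd_pairLaw (p r : unitInterval) (x : Bool × Bool) :
    ∫ y, spin y.2 ∂pairLaw p r x = (r - p) * spin x.2 + (r + p - 1) * spin x.1 := by
  rw [integral_pairLaw p r x fun y => spin y.2]
  rcases x with ⟨x, y⟩
  cases x <;> cases y <;> simp [spin] <;> ring

/-- The other site of the pair of `i` in the pairing of type `u`. -/
def partner (u : ℕ) (i : ℤ) : ℤ := if (i + u) % 2 = 0 then i + 1 else i - 1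

theorem measurable_spin : Measurable spin := measurable_of_countable _

theorem integral_spin_step (p r : unitInterval) (u : ℕ) (η : Line) (i : ℤ) :
    ∫ ζ, spin (ζ i) ∂step p r u η =
      (r - p) * spin (η i) + (r + p - 1) * spin (η (partner u i)) := by
  have hm : Measurable fun ζ : Line => spin (ζ i) := measurable_spin.comp (measurable_pi_apply i)
  have key (f : Bool × Bool → ℝ) (n : ℤ) :
      ∫ w : ℤ → Bool × Bool, f (w n) ∂(Measure.infinitePi fun n => pairLaw p r (toPairs u η n)) =
        ∫ y, f y ∂pairLaw p r (toPairs u η n) := by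
    rw [← Measure.infinitePi_map_eval (fun n => pairLaw p r (toPairs u η n)) n,
      integral_map (measurable_pi_apply n).aemeasurable
        (measurable_of_countable f).aestronglyMeasurable]
  change ∫ ζ, spin (ζ i) ∂((Measure.infinitePi fun n : ℤ =>
    pairLaw p r (toPairs u η n)).map (ofPairs u)) = _
  rw [integral_map (measurable_ofPairs u).aemeasurable hm.aestronglyMeasurable]
  unfold ofPairs partner
  split_ifs with h
  · rw [key (fun y => spin y.1), integral_spin_fst_pairLaw, toPairs]
    rw [show 2 * ((i + u) / 2) - (u : ℤ) = i by omega,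
      show 2 * ((i + u) / 2) + 1 - (u : ℤ) = i + 1 by omega]
  · rw [key (fun y => spin y.2), integral_spin_snd_pairLaw, toPairs]
    rw [show 2 * ((i + u) / 2) - (u : ℤ) = i - 1 by omega,
      show 2 * ((i + u) / 2) + 1 - (u : ℤ) = i by omega]

/-! ### Iteration along the trajectory -/

instance (μ : Measure Line) [IsProbabilityMeasure μ] (p r : unitInterval) :
    IsProbabilityMeasure (law μ p r) := by
  unfold law; infer_instance

theorem law_map_zero (μ : Measure Line) [IsProbabilityMeasure μ] (p r : unitInterval) :
    (law μ p r).map (fun O => O 0) = μ := by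
  have h0 : (fun O : Config => O 0) =
      (fun x : (Π _ : Finset.Iic 0, Line) => x ⟨0, by simp⟩) ∘ Preorder.frestrictLe 0 := rfl
  unfold law Kernel.trajMeasure
  rw [h0, ← Measure.map_map (by fun_prop) (by fun_prop), Measure.map_comp _ _ (by fun_prop),
    Kernel.traj_map_frestrictLe, Kernel.partialTraj_self, Measure.id_comp,
    Measure.map_map (by fun_prop) (by fun_prop)]
  exact Measure.map_id

theorem integrable_of_abs_le {Ω : Type*} [MeasurableSpace Ω] {P : Measure Ω} [IsFiniteMeasure P]
    {f : Ω → ℝ} (hf : Measurable f) {C : ℝ} (h : ∀ ω, |f ω| ≤ C) : Integrable f P :=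
  Integrable.of_bound hf.aestronglyMeasurable C (.of_forall h)

/-- Markov property at time `t`. The test function `g` of the initial line lets one recursion serve
both means (`g = 1`) and mixed moments with `e(0,0)`. -/
theorem integral_mul_spin_succ (μ : Measure Line) [IsProbabilityMeasure μ] (p r : unitInterval)
    {g : Line → ℝ} (hg : Measurable g) (hg1 : ∀ η, |g η| ≤ 1) (i : ℤ) (t : ℕ) :
    ∫ O, g (O 0) * spin (O (t + 1) i) ∂law μ p r =
      (r - p) * ∫ O, g (O 0) * spin (O t i) ∂law μ p r +
      (r + p - 1) * ∫ O, g (O 0) * spin (O t (partner (t % 2) i)) ∂law μ p r := by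
  have hb (x : ℝ) (b : Bool) (hx : |x| ≤ 1) : |x * spin b| ≤ 1 := by
    rwa [abs_mul, abs_spin, mul_one]
  have hs := measurable_spin
  let F : (Π _ : Finset.Iic t, Line) × Line → ℝ := fun y =>
    g (y.1 ⟨0, by simp⟩) * spin (y.2 i)
  have hF : Measurable F := by fun_prop
  have hmarkov := Kernel.map_frestrictLe_trajMeasure_compProd_eq_map_trajMeasure (X := fun _ => Line)
    (μ₀ := μ) (κ := fun t => (step p r (t % 2)).comap
      (fun h : (Π _ : Finset.Iic t, Line) => h ⟨t, Finset.mem_Iic.2 le_rfl⟩)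
      (measurable_pi_apply _)) (a := t)
  change (law μ p r).map _ ⊗ₘ _ = (law μ p r).map _ at hmarkov
  have hl : ∫ O, g (O 0) * spin (O (t + 1) i) ∂law μ p r =
      ∫ y, F y ∂((law μ p r).map fun O : Config => (Preorder.frestrictLe t O, O (t + 1))) := by
    rw [integral_map (by fun_prop) hF.aestronglyMeasurable]
    rfl
  have hint (j : ℤ) : Integrable (fun O : Config => g (O 0) * spin (O t j)) (law μ p r) :=
    integrable_of_abs_le (by fun_prop) fun O => hb _ _ (hg1 _)
  rw [hl, ← hmarkov, Measure.integral_compProd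
      (integrable_of_abs_le hF fun y => hb _ _ (hg1 _)),
    integral_map (by fun_prop) ?_, ← integral_const_mul, ← integral_const_mul,
    ← integral_add ((hint _).const_mul _) ((hint _).const_mul _)]
  · congr 1 with O
    simp only [F, Kernel.comap_apply, integral_const_mul, integral_spin_step]
    simp only [Preorder.frestrictLe_apply]
    ring
  · simp only [F, Kernel.comap_apply, integral_const_mul, integral_spin_step]
    exact Measurable.aestronglyMeasurable (by fun_prop)

/-- This is `|x| + |y| = max |x + y| |x - y|` with `x + y = 2r - 1` and `x - y = 1 - 2p`. -/
theorem abs_sub_add_abs_add_sub_one_le_lam (p r : unitInterval) :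
    |(r : ℝ) - p| + |(r : ℝ) + p - 1| ≤ lam p r := by
  unfold lam
  rcases abs_cases ((r : ℝ) - p) with h | h <;> rcases abs_cases ((r : ℝ) + p - 1) with h' | h' <;>
  rcases abs_cases (1 - 2 * (p : ℝ)) with k | k <;> rcases abs_cases (1 - 2 * (r : ℝ)) with k' | k' <;>
  first
  | exact le_max_of_le_left (by linarith)
  | exact le_max_of_le_right (by linarith)

theorem lam_nonneg (p r : unitInterval) : 0 ≤ lam p r := le_max_of_le_left (abs_nonneg _)

theorem lam_le_one (p r : unitInterval) : lam p r ≤ 1 := by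
  refine max_le ?_ ?_ <;> rw [abs_le] <;> constructor <;>
    linarith [p.2.1, p.2.2, r.2.1, r.2.2]

/-- The mean spin of an edge given the initial line is a linear combination of the initial spins,
with coefficients of total mass at most `λ ^ t`. -/
theorem exists_spin_weights (p r : unitInterval) (t : ℕ) (i : ℤ) :
    ∃ (S : Finset ℤ) (w : ℤ → ℝ), (∑ j ∈ S, |w j| ≤ lam p r ^ t) ∧
      ∀ (μ : Measure Line) [IsProbabilityMeasure μ] (g : Line → ℝ), Measurable g →
        (∀ η, |g η| ≤ 1) →
        ∫ O, g (O 0) * spin (O t i) ∂law μ p r = ∑ j ∈ S, w j * ∫ η, g η * spin (η j) ∂μ := by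
  classical
  induction t generalizing i with
  | zero =>
    refine ⟨{i}, fun _ => 1, by simp, fun μ _ g hg _ => ?_⟩
    have hs := measurable_spin
    have hm : Measurable fun η : Line => g η * spin (η i) := by fun_prop
    rw [Finset.sum_singleton, one_mul]
    conv_rhs => rw [← law_map_zero μ p r]
    rw [integral_map (measurable_pi_apply 0).aemeasurable hm.aestronglyMeasurable]
  | succ t ih =>
    obtain ⟨S₁, w₁, h₁, e₁⟩ := ih i
    obtain ⟨S₂, w₂, h₂, e₂⟩ := ih (partner (t % 2) i)
    have hext (S : Finset ℤ) (T : Finset ℤ) (hST : S ⊆ T) (f : ℤ → ℝ) :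
        ∑ j ∈ T, (if j ∈ S then f j else 0) = ∑ j ∈ S, f j := by
      rw [Finset.sum_ite_mem, Finset.inter_eq_right.2 hST]
    have k₁ := hext S₁ (S₁ ∪ S₂) Finset.subset_union_left
    have k₂ := hext S₂ (S₁ ∪ S₂) Finset.subset_union_right
    -- Both weight families are extended by zero to the common support before being combined.
    refine ⟨S₁ ∪ S₂, fun j => (r - p) * (if j ∈ S₁ then w₁ j else 0) +
      (r + p - 1) * (if j ∈ S₂ then w₂ j else 0), ?_, fun μ _ g hg hg1 => ?_⟩
    · calc _ ≤ ∑ j ∈ S₁ ∪ S₂, (|(r : ℝ) - p| * (if j ∈ S₁ then |w₁ j| else 0) +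
            |(r : ℝ) + p - 1| * (if j ∈ S₂ then |w₂ j| else 0)) := by
            refine Finset.sum_le_sum fun j _ => (abs_add_le _ _).trans ?_
            simp only [abs_mul, apply_ite abs, abs_zero, le_refl]
        _ = |(r : ℝ) - p| * ∑ j ∈ S₁, |w₁ j| + |(r : ℝ) + p - 1| * ∑ j ∈ S₂, |w₂ j| := by
            rw [Finset.sum_add_distrib, ← Finset.mul_sum, ← Finset.mul_sum, k₁, k₂]
        _ ≤ |(r : ℝ) - p| * lam p r ^ t + |(r : ℝ) + p - 1| * lam p r ^ t := by gcongr
        _ ≤ lam p r ^ (t + 1) := by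
            rw [← add_mul, pow_succ']
            exact mul_le_mul_of_nonneg_right (abs_sub_add_abs_add_sub_one_le_lam p r)
              (pow_nonneg (lam_nonneg p r) _)
    · rw [integral_mul_spin_succ μ p r hg hg1, e₁ μ g hg hg1, e₂ μ g hg hg1, ← k₁, ← k₂,
        Finset.mul_sum, Finset.mul_sum, ← Finset.sum_add_distrib]
      refine Finset.sum_congr rfl fun j _ => ?_
      dsimp only
      split_ifs <;> ring

/-! ### Variances and covariances of indicators -/

/-- The real number `0` or `1` representing a state. -/
def bit (x : Bool) : ℝ := if x then 1 else 0

theorem measurable_bit : Measurable bit := measurable_of_countable _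

theorem spin_eq (x : Bool) : spin x = 2 * bit x - 1 := by
  cases x <;> norm_num [spin, bit]

theorem bit_sq (x : Bool) : bit x ^ 2 = bit x := by cases x <;> simp [bit]

theorem bit_nonneg (x : Bool) : 0 ≤ bit x := by cases x <;> simp [bit]

theorem bit_le_one (x : Bool) : bit x ≤ 1 := by cases x <;> simp [bit]

theorem abs_bit_le (x : Bool) : |bit x| ≤ 1 := by
  rw [abs_of_nonneg (bit_nonneg x)]; exact bit_le_one x

theorem covariance_bit_self {Ω : Type*} [MeasurableSpace Ω] {P : Measure Ω} {Z : Ω → Bool}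
    (hZ : Measurable Z) :
    cov[fun ω => bit (Z ω), fun ω => bit (Z ω); P] = Var[fun ω => bit (Z ω); P] :=
  covariance_self (measurable_bit.comp hZ).aemeasurable

section Bits

variable {Ω : Type*} [MeasurableSpace Ω] {P : Measure Ω} [IsProbabilityMeasure P]
  {Z Z' : Ω → Bool}

theorem integrable_bit (hZ : Measurable Z) : Integrable (fun ω => bit (Z ω)) P :=
  integrable_of_abs_le (measurable_bit.comp hZ) fun _ => abs_bit_le _

theorem memLp_bit (hZ : Measurable Z) : MemLp (fun ω => bit (Z ω)) 2 P :=
  MemLp.of_bound (measurable_bit.comp hZ).aestronglyMeasurable 1 (.of_forall fun _ => abs_bit_le _)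

theorem memLp_spin (hZ : Measurable Z) : MemLp (fun ω => spin (Z ω)) 2 P :=
  MemLp.of_bound (measurable_spin.comp hZ).aestronglyMeasurable 1
    (.of_forall fun _ => (abs_spin _).le)

theorem variance_bit (hZ : Measurable Z) :
    Var[fun ω => bit (Z ω); P] = (∫ ω, bit (Z ω) ∂P) - (∫ ω, bit (Z ω) ∂P) ^ 2 := by
  rw [variance_eq_sub (memLp_bit hZ)]
  congr 2
  exact funext fun ω => bit_sq _

theorem integral_spin (hZ : Measurable Z) :
    ∫ ω, spin (Z ω) ∂P = 2 * ∫ ω, bit (Z ω) ∂P - 1 := by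
  simp_rw [spin_eq]
  rw [integral_sub ((integrable_bit hZ).const_mul 2) (integrable_const 1), integral_const_mul]
  simp

theorem covariance_spin_right (X : Ω → ℝ) (hZ : Measurable Z) :
    cov[X, fun ω => spin (Z ω); P] = 2 * cov[X, fun ω => bit (Z ω); P] := by
  simp_rw [spin_eq]
  rw [covariance_sub_const_right ((integrable_bit hZ).const_mul 2), covariance_const_mul_right]

/-- The covariance of the indicators of two events is at most the variance of each of them. -/
theorem abs_covariance_bit_le (hZ : Measurable Z) (hZ' : Measurable Z') :
    |cov[fun ω => bit (Z ω), fun ω => bit (Z' ω); P]| ≤ Var[fun ω => bit (Z ω); P] := by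
  have hm := measurable_bit
  rw [covariance_eq_sub (memLp_bit hZ) (memLp_bit hZ'), variance_bit hZ]
  change |(∫ ω, bit (Z ω) * bit (Z' ω) ∂P) - _| ≤ _
  have hi : Integrable (fun ω => bit (Z ω) * bit (Z' ω)) P :=
    integrable_of_abs_le (C := 1) (by fun_prop) fun ω => by
      rw [abs_mul]; exact mul_le_one₀ (abs_bit_le _) (abs_nonneg _) (abs_bit_le _)
  have h0 : 0 ≤ ∫ ω, bit (Z ω) * bit (Z' ω) ∂P :=
    integral_nonneg fun ω => mul_nonneg (bit_nonneg _) (bit_nonneg _)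
  have h1 : ∫ ω, bit (Z ω) * bit (Z' ω) ∂P ≤ ∫ ω, bit (Z ω) ∂P :=
    integral_mono hi (integrable_bit hZ) fun ω =>
      mul_le_of_le_one_right (bit_nonneg _) (bit_le_one _)
  have h2 : ∫ ω, bit (Z ω) * bit (Z' ω) ∂P ≤ ∫ ω, bit (Z' ω) ∂P :=
    integral_mono hi (integrable_bit hZ') fun ω =>
      mul_le_of_le_one_left (bit_nonneg _) (bit_le_one _)
  -- Integrated form of `(1 - bit Z) * (1 - bit Z') ≥ 0`.
  have h3 : (∫ ω, bit (Z ω) ∂P) + (∫ ω, bit (Z' ω) ∂P) - ∫ ω, bit (Z ω) * bit (Z' ω) ∂P ≤ 1 := by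
    rw [← integral_add (integrable_bit hZ) (integrable_bit hZ')]
    refine (integral_sub ((integrable_bit hZ).add (integrable_bit hZ')) hi).symm.trans_le ?_
    refine (integral_mono (((integrable_bit hZ).add (integrable_bit hZ')).sub hi)
      (integrable_const 1) fun ω => ?_).trans (by simp)
    change bit (Z ω) + bit (Z' ω) - bit (Z ω) * bit (Z' ω) ≤ 1
    nlinarith [bit_le_one (Z ω), bit_le_one (Z' ω)]
  generalize ∫ ω, bit (Z ω) * bit (Z' ω) ∂P = x at *
  generalize ∫ ω, bit (Z ω) ∂P = q at *
  generalize ∫ ω, bit (Z' ω) ∂P = m at *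
  rw [abs_le]
  -- Here `x - q m = (1 - q) x - q (m - x)`, with `0 ≤ x ≤ q` and `0 ≤ m - x ≤ 1 - q`, so both
  -- products lie in `[0, q (1 - q)]`.
  constructor <;> nlinarith

end Bits

/-! ### Correlations in terms of the initial law -/

theorem measurable_site (x : ℤ × ℕ) : Measurable fun O : Config => O x.2 x.1 :=
  (measurable_pi_apply x.1).comp (measurable_pi_apply x.2)

/-- The covariance of an edge with the edge `(0, 0)`, and the mean of its spin, in terms of the
initial law. -/
theorem exists_covariance_weights (p r : unitInterval) (t : ℕ) (i : ℤ) :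
    ∃ (S : Finset ℤ) (w : ℤ → ℝ), (∑ j ∈ S, |w j| ≤ lam p r ^ t) ∧
      ∀ (μ : Measure Line) [IsProbabilityMeasure μ],
        cov[e (0, 0), e (i, t); law μ p r] =
          ∑ j ∈ S, w j * cov[fun η => bit (η 0), fun η => bit (η j); μ] ∧
        2 * ∫ O, e (i, t) O ∂law μ p r - 1 = ∑ j ∈ S, w j * (2 * ∫ η, bit (η j) ∂μ - 1) := by
  obtain ⟨S, w, hw, h⟩ := exists_spin_weights p r t i
  refine ⟨S, w, hw, fun μ _ => ?_⟩
  have hη (j : ℤ) : Measurable fun η : Line => η j := measurable_pi_apply j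
  have hm (x : ℤ × ℕ) := measurable_site x
  have hb := measurable_bit.comp (hη 0)
  have h1 := h μ (fun _ => 1) measurable_const (by simp)
  have h2 := h μ (fun η => bit (η 0)) hb fun η => abs_bit_le _
  simp only [one_mul] at h1
  have h0 : ∫ O, bit (O 0 0) ∂law μ p r = ∫ η, bit (η 0) ∂μ := by
    conv_rhs => rw [← law_map_zero μ p r]
    rw [integral_map (measurable_pi_apply 0).aemeasurable hb.aestronglyMeasurable]
  constructor
  · have e1 : cov[e (0, 0), e (i, t); law μ p r] =
        cov[fun O => bit (O 0 0), fun O => spin (O t i); law μ p r] / 2 := by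
      rw [covariance_spin_right _ (hm (i, t)), mul_div_cancel_left₀ _ two_ne_zero]
      rfl
    rw [e1, covariance_eq_sub (memLp_bit (hm (0, 0))) (memLp_spin (hm (i, t)))]
    change ((∫ O, bit (O 0 0) * spin (O t i) ∂law μ p r) - _) / 2 = _
    rw [h2, h1, h0, Finset.mul_sum, ← Finset.sum_sub_distrib, Finset.sum_div]
    refine Finset.sum_congr rfl fun j _ => ?_
    have e2 := covariance_spin_right (P := μ) (fun η => bit (η 0)) (hη j)
    rw [covariance_eq_sub (memLp_bit (hη 0)) (memLp_spin (hη j))] at e2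
    change (∫ η, bit (η 0) * spin (η j) ∂μ) - _ = _ at e2
    linear_combination w j / 2 * e2
  · rw [integral_spin (hm (i, t))] at h1
    refine h1.trans (Finset.sum_congr rfl fun j _ => ?_)
    rw [integral_spin (hη j)]

theorem variance_law_zero (μ : Measure Line) [IsProbabilityMeasure μ] (p r : unitInterval) :
    Var[e (0, 0); law μ p r] = Var[fun η => bit (η 0); μ] := by
  conv_rhs => rw [← law_map_zero μ p r]
  have hb : Measurable fun η : Line => bit (η 0) := measurable_bit.comp (measurable_pi_apply 0)
  rw [variance_map hb.aemeasurable (measurable_pi_apply 0).aemeasurable]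
  rfl

theorem isProbabilityMeasure_bernoulli (q : unitInterval) :
    IsProbabilityMeasure (ENNReal.ofReal (q : ℝ) • Measure.dirac true
      + ENNReal.ofReal (1 - (q : ℝ)) • Measure.dirac false) := by
  constructor
  have h : ENNReal.ofReal (q : ℝ) + ENNReal.ofReal (1 - (q : ℝ)) = 1 := by
    rw [← ENNReal.ofReal_add q.2.1 (sub_nonneg.2 q.2.2)]
    simp
  simp [h]

theorem integral_bit_productMeasure (q : unitInterval) (j : ℤ) :
    ∫ η, bit (η j) ∂productMeasure q = q := by
  have := isProbabilityMeasure_bernoulli q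
  have h := Measure.infinitePi_map_eval (fun _ : ℤ => ENNReal.ofReal (q : ℝ) • Measure.dirac true
      + ENNReal.ofReal (1 - (q : ℝ)) • Measure.dirac false) j
  change (productMeasure q).map _ = _ at h
  have hj : Measurable fun η : Line => η j := measurable_pi_apply j
  rw [← integral_map (f := bit) hj.aemeasurable measurable_bit.aestronglyMeasurable, h,
    integral_add_measure ((integrable_dirac (by simp)).smul_measure (by simp))
      ((integrable_dirac (by simp)).smul_measure (by simp)),
    integral_smul_measure, integral_smul_measure]
  simp [bit, q.2.1]

theorem covariance_bit_productMeasure (q : unitInterval) {i j : ℤ} (hij : i ≠ j) :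
    cov[fun η => bit (η i), fun η => bit (η j); productMeasure q] = 0 := by
  have := isProbabilityMeasure_bernoulli q
  have h := iIndepFun_infinitePi (P := fun _ : ℤ => ENNReal.ofReal (q : ℝ) • Measure.dirac true
      + ENNReal.ofReal (1 - (q : ℝ)) • Measure.dirac false) (X := fun _ => bit)
      (fun _ => measurable_bit)
  exact (h.indepFun hij).covariance_eq_zero (memLp_bit (measurable_pi_apply i))
    (memLp_bit (measurable_pi_apply j))

/-- For `t ≥ 1`, each of the two half-power terms dominates a smaller one: one absorbs `x ^ (t -
1)`, the other is at least `x ^ t`. -/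
theorem pow_le_error_bound {x : ℝ} (h0 : 0 ≤ x) (h1 : x ≤ 1) (t : ℕ) :
    x ^ t ≤ 2 * (x ^ ((t : ℤ) - 1 - ((t / 2 : ℕ) : ℤ)) + x ^ (t / 2) - x ^ ((t : ℤ) - 1)) := by
  rcases t with _ | t
  -- At `t = 0` both integer exponents are `-1`, so these terms cancel even when `x = 0`.
  · simp
  · have e1 : ((t + 1 : ℕ) : ℤ) - 1 - (((t + 1) / 2 : ℕ) : ℤ) = ((t - (t + 1) / 2 : ℕ) : ℤ) := by
      omega
    have e2 : ((t + 1 : ℕ) : ℤ) - 1 = (t : ℤ) := by omega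
    rw [e1, e2, zpow_natCast, zpow_natCast]
    have h2 : x ^ (t + 1) ≤ x ^ ((t + 1) / 2) := pow_le_pow_of_le_one h0 h1 (by omega)
    have h3 : x ^ t ≤ x ^ (t - (t + 1) / 2) := pow_le_pow_of_le_one h0 h1 (by omega)
    have h4 : 0 ≤ x ^ (t + 1) := pow_nonneg h0 _
    linarith

/-- The free law has the stationary weights as correlations. -/
theorem C8_eq (a b c d : ℝ≥0) (i : ℤ) (t : ℕ) {S : Finset ℤ} {w : ℤ → ℝ}
    (h : ∀ (μ : Measure Line) [IsProbabilityMeasure μ],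
        cov[e (0, 0), e (i, t); law μ (ratio a c) (ratio b d)] =
          ∑ j ∈ S, w j * cov[fun η => bit (η 0), fun η => bit (η j); μ] ∧
        2 * ∫ O, e (i, t) O ∂law μ (ratio a c) (ratio b d) - 1 =
          ∑ j ∈ S, w j * (2 * ∫ η, bit (η j) ∂μ - 1)) :
    C8 a b c d i t = ∑ j ∈ S, w j * if j = 0 then 1 else 0 := by
  unfold C8 freeLaw edgeCorr
  set q : unitInterval := ⟨1 / 2, by norm_num, by norm_num⟩
  obtain ⟨h1, h2⟩ := h (productMeasure q)
  have hq (j : ℤ) : ∫ η, bit (η j) ∂productMeasure q = 1 / 2 := integral_bit_productMeasure q j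
  have hv : Var[fun η => bit (η 0); productMeasure q] = 1 / 4 := by
    rw [variance_bit (measurable_pi_apply 0), hq]; norm_num
  have hc (j : ℤ) : cov[fun η => bit (η 0), fun η => bit (η j); productMeasure q] =
      1 / 4 * if j = 0 then 1 else 0 := by
    split_ifs with hj
    · rw [hj, covariance_bit_self (measurable_pi_apply 0), hv,
        mul_one]
    · rw [covariance_bit_productMeasure q (Ne.symm hj), mul_zero]
  -- Zero mean spins at time `0` keep the mean spin zero, which fixes the variance of a bit; full
  -- stationarity of the product measure is not required.
  have hv' : Var[e (i, t); law (productMeasure q) (ratio a c) (ratio b d)] = 1 / 4 := by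
    have : ∫ O, e (i, t) O ∂law (productMeasure q) (ratio a c) (ratio b d) = 1 / 2 := by
      simp only [hq] at h2
      norm_num at h2
      linarith
    refine (variance_bit (measurable_site (i, t))).trans ?_
    change (∫ O, e (i, t) O ∂_) - (∫ O, e (i, t) O ∂_) ^ 2 = _
    rw [this]; norm_num
  rw [variance_law_zero, hv, hv', Real.mul_self_sqrt (by norm_num), h1, Finset.sum_div]
  refine Finset.sum_congr rfl fun j _ => ?_
  rw [hc]; ring

/-- The factor `√Var e(i,t)` cancels. If it vanishes, the left side is `0` by the division
convention, and the covariance vanishes too since it is bounded by that variance. -/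
theorem sqrt_variance_mul_edgeCorr (μ : Measure Line) [IsProbabilityMeasure μ]
    (p r : unitInterval) (hvar : Var[e (0, 0); law μ p r] ≠ 0) (i : ℤ) (t : ℕ) :
    √(Var[e (i, t); law μ p r] / Var[e (0, 0); law μ p r]) * edgeCorr (law μ p r) (0, 0) (i, t) =
      cov[e (0, 0), e (i, t); law μ p r] / Var[e (0, 0); law μ p r] := by
  have hV : 0 < Var[e (0, 0); law μ p r] := (variance_nonneg _ _).lt_of_ne' hvar
  unfold edgeCorr
  rcases (variance_nonneg (e (i, t)) (law μ p r)).eq_or_lt with h | h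
  · have hc : |cov[e (i, t), e (0, 0); law μ p r]| ≤ Var[e (i, t); law μ p r] :=
      abs_covariance_bit_le (measurable_site (i, t)) (measurable_site (0, 0))
    rw [← h, abs_nonpos_iff, covariance_comm] at hc
    simp [hc]
  · rw [Real.sqrt_div h.le]
    have h1 := Real.sqrt_pos.2 hV
    have h2 := Real.sqrt_pos.2 h
    conv_rhs => rw [← Real.mul_self_sqrt hV.le]
    field_simp

end EightVertex

end

theorem mainTheorem3 (a b c d : ℝ≥0) (hpos : 0 < a + c) (hw : a + c = b + d)
    (p r : unitInterval) (hp : p = ratio a c) (hr : r = ratio b d)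
    (μ : Measure Line) [IsProbabilityMeasure μ]
    (hvar : Var[e (0, 0); law μ p r] ≠ 0) (i : ℤ) (t : ℕ) :
    |√(Var[e (i, t); law μ p r] / Var[e (0, 0); law μ p r])
          * edgeCorr (law μ p r) (0, 0) (i, t) - C8 a b c d i t|
      ≤ 2 * (lam p r ^ ((t : ℤ) - 1 - ((t / 2 : ℕ) : ℤ)) + lam p r ^ (t / 2)
          - lam p r ^ ((t : ℤ) - 1)) := by
  subst hp hr
  refine le_trans ?_ (pow_le_error_bound (lam_nonneg _ _) (lam_le_one _ _) t)
  obtain ⟨S, w, hS, h⟩ := exists_covariance_weights (ratio a c) (ratio b d) t i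
  rw [sqrt_variance_mul_edgeCorr μ _ _ hvar, C8_eq a b c d i t h, (h μ).1, Finset.sum_div,
    ← Finset.sum_sub_distrib]
  refine (Finset.abs_sum_le_sum_abs _ _).trans ((Finset.sum_le_sum fun j _ => ?_).trans hS)
  rw [variance_law_zero] at hvar ⊢
  rw [mul_div_assoc, ← mul_sub, abs_mul]
  -- It remains to bound the factor of `|w j|` by `1`: it is `|1 - 1|` at `j = 0` and a
  -- covariance-to-variance ratio elsewhere.
  refine mul_le_of_le_one_right (abs_nonneg _) ?_
  split_ifs with hj
  · rw [hj, covariance_bit_self (measurable_pi_apply 0),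
      div_self hvar]
    simp
  · rw [sub_zero, abs_div, abs_of_nonneg (variance_nonneg _ _)]
    exact div_le_one_of_le₀ (abs_covariance_bit_le (measurable_pi_apply 0) (measurable_pi_apply j))
      (variance_nonneg _ _)
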